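/- Let $R$ be a commutative ring and $n$ a positive integer. Let $P=\mathrm{Par}(n)$ be the set of partitions of $n$, partially ordered by dominance ($\lambda\trianglelefteq\mu$ iff $\lambda_1+\dots+\lambda_k\le\mu_1+\dots+\mu_k$ for all $k$), and let $\mathrm{Sym}(n)$ be the group of permutations of $\{1,\dots,n\}$. For $\sigma\in\mathrm{Sym}(n)$ let $\mathrm{sh}(\sigma)\in P$ be the shape of the pair of standard tableaux that the Robinson--Schensted correspondence (by row insertion) assigns to the word $\sigma(1)\sigma(2)\cdots\sigma(n)$, and for $\Gamma\subseteq P$ put $G(\Gamma)=\{\sigma\in\mathrm{Sym}(n) : \mathrm{sh}(\sigma)\in\Gamma\}$; write $RG(\Gamma)$ for the $R$-span of $G(\Gamma)$ in the group algebra $R\,\mathrm{Sym}(n)$. For $\mu=(\mu_1,\dots,\mu_m)\in P$ with $\mu_1\ge\dots\ge\mu_m>0$ let $\mathrm{Sym}(\mu)=\mathrm{Sym}(X_1)\times\cdots\times\mathrm{Sym}(X_m)\le\mathrm{Sym}(n)$ be the Young subgroup, where $X_1=\{1,\dots,\mu_1\}$, $X_2=\{\mu_1+1,\dots,\mu_1+\mu_2\}$,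 and so on, and for $\Delta\subseteq P$ let $I_R(\Delta)$ be the two-sided ideal of $R\,\mathrm{Sym}(n)$ generated by the elements $\sum_{\sigma\in\mathrm{Sym}(\mu)}\sigma$, $\mu\in\Delta$. Let $\Delta\subseteq P$ be co-saturated, i.e. whenever $\mu\in\Delta$, $\lambda\in P$ and $\mu\trianglelefteq\lambda$, then $\lambda\in\Delta$. Suppose that $P\setminus\Delta$ has a unique maximal element with respect to dominance. Then $$R\,\mathrm{Sym}(n)=RG(P\setminus\Delta)+I_R(\Delta).$$ -/

import Mathlib

namespace SymGroupAlg

/-! ### Partitions and the dominance order -/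

/-- The parts of `p` listed in weakly decreasing order `p₁ ≥ p₂ ≥ ⋯`. -/
def sortedParts {n : ℕ} (p : n.Partition) : List ℕ := p.parts.sort (· ≥ ·)

/-- The sum `p₁ + ⋯ + p_k` of the `k` largest parts of `p` (all of them if there are fewer). -/
def partialSum {n : ℕ} (p : n.Partition) (k : ℕ) : ℕ := ((sortedParts p).take k).sum

theorem eq_of_take_sum_eq : ∀ (l₁ l₂ : List ℕ), (∀ x ∈ l₁, 0 < x) → (∀ x ∈ l₂, 0 < x) →
    (∀ k, (l₁.take k).sum = (l₂.take k).sum) → l₁ = l₂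
  | [], [], _, _, _ => rfl
  | [], b :: l₂, _, h₂, h => by
      have h1 := h 1
      have hb := h₂ b (by simp)
      simp at h1
      omega
  | a :: l₁, [], h₁, _, h => by
      have h1 := h 1
      have ha := h₁ a (by simp)
      simp at h1
      omega
  | a :: l₁, b :: l₂, h₁, h₂, h => by
      have hab : a = b := by simpa using h 1
      subst hab
      congr 1
      refine eq_of_take_sum_eq l₁ l₂ (fun x hx => h₁ x (by simp [hx]))
        (fun x hx => h₂ x (by simp [hx])) (fun k => ?_)
      simpa using h (k + 1)

/-- The dominance order: `p ≤ q` iff `p₁ + ⋯ + p_k ≤ q₁ + ⋯ + q_k` for all `k`. -/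
instance dominanceOrder (n : ℕ) : PartialOrder n.Partition where
  le p q := ∀ k, partialSum p k ≤ partialSum q k
  le_refl _ _ := le_rfl
  le_trans _ _ _ h₁ h₂ k := (h₁ k).trans (h₂ k)
  le_antisymm p q h₁ h₂ := by
    have h : sortedParts p = sortedParts q :=
      eq_of_take_sum_eq _ _ (fun x hx => p.parts_pos (by simpa [sortedParts] using hx))
        (fun x hx => q.parts_pos (by simpa [sortedParts] using hx))
        (fun k => le_antisymm (h₁ k) (h₂ k))
    have h' := congrArg (fun l : List ℕ => (l : Multiset ℕ)) h
    exact Nat.Partition.ext (by simpa [sortedParts] using h')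

/-! ### Robinson–Schensted row insertion -/

section RobinsonSchensted

variable {α : Type*} [LinearOrder α]

/-- Insert `x` into a row: `x` replaces (bumps) the leftmost entry larger than `x`, which is
returned as the second component; if there is none, `x` is put at the end of the row. -/
def rowInsert (x : α) : List α → List α × Option α
  | [] => ([x], none)
  | y :: ys => if x < y then (x :: ys, some y)
      else (y :: (rowInsert x ys).1, (rowInsert x ys).2)

/-- Insert `x` into a tableau given by its list of rows: the entry bumped from a row is inserted
into the next row. -/
def tableauInsert (x : α) : List (List α) → List (List α)
  | [] => [[x]]
  | r :: rs => match (rowInsert x r).2 with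
      | none => (rowInsert x r).1 :: rs
      | some y => (rowInsert x r).1 :: tableauInsert y rs

/-- The insertion tableau of a word: its letters are inserted from left to right into the empty
tableau. -/
def insertionTableau (w : List α) : List (List α) :=
  w.foldl (fun T x => tableauInsert x T) []

theorem rowInsert_length (x : α) (r : List α) :
    0 < (rowInsert x r).1.length ∧
      (rowInsert x r).1.length + (rowInsert x r).2.toList.length = r.length + 1 := by
  induction r with
  | nil => simp [rowInsert]
  | cons y ys ih =>
    by_cases h : x < y
    · simp [rowInsert, h]
    · simp only [rowInsert, h, if_false, List.length_cons]
      omega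

theorem tableauInsert_lengths (x : α) (T : List (List α)) (hT : ∀ r ∈ T, 0 < r.length) :
    (∀ r ∈ tableauInsert x T, 0 < r.length) ∧
      ((tableauInsert x T).map List.length).sum = (T.map List.length).sum + 1 := by
  induction T generalizing x with
  | nil => simp [tableauInsert]
  | cons r rs ih =>
    have hr := rowInsert_length x r
    have hrs : ∀ r ∈ rs, 0 < r.length := fun r' h' => hT r' (by simp [h'])
    rw [tableauInsert]
    cases hy : (rowInsert x r).2 with
    | none =>
      simp only [hy, Option.toList_none, List.length_nil] at hr
      simp only [List.mem_cons, forall_eq_or_imp, List.map_cons, List.sum_cons]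
      exact ⟨⟨hr.1, hrs⟩, by omega⟩
    | some y =>
      have h2 := ih y hrs
      simp only [hy, Option.toList_some, List.length_singleton] at hr
      simp only [List.mem_cons, forall_eq_or_imp, List.map_cons, List.sum_cons]
      exact ⟨⟨hr.1, h2.1⟩, by omega⟩

theorem insertionTableau_lengths (w : List α) :
    (∀ r ∈ insertionTableau w, 0 < r.length) ∧
      ((insertionTableau w).map List.length).sum = w.length := by
  induction w using List.reverseRecOn with
  | nil => simp [insertionTableau]
  | append_singleton w x ih =>
    have h := tableauInsert_lengths x _ ih.1
    have e : insertionTableau (w ++ [x]) = tableauInsert x (insertionTableau w) := by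
      simp [insertionTableau]
    rw [e, List.length_append, List.length_singleton, ← ih.2]
    exact h

end RobinsonSchensted

/-- The shape of a permutation `σ`: the partition formed by the row lengths of the insertion
tableau of the word `σ(1) σ(2) ⋯ σ(n)`. (The recording tableau has the same shape.) -/
def shape {n : ℕ} (σ : Equiv.Perm (Fin n)) : n.Partition where
  parts := ((insertionTableau (List.ofFn σ)).map List.length : List ℕ)
  parts_pos := by
    intro i hi
    obtain ⟨r, hr, rfl⟩ := List.mem_map.1 (Multiset.mem_coe.1 hi)
    exact (insertionTableau_lengths (List.ofFn σ)).1 r hr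
  parts_sum := by
    simpa using (insertionTableau_lengths (List.ofFn σ)).2

/-- The set `G(Γ)` of permutations whose shape lies in `Γ`. -/
def permsOfShape {n : ℕ} (Γ : Set n.Partition) : Set (Equiv.Perm (Fin n)) :=
  {σ | shape σ ∈ Γ}

/-! ### Young subgroups and the ideals they generate -/

/-- The `r`-th (counting from `0`) of the consecutive blocks of sizes `μ₁, μ₂, …` into which
`Fin n` is cut by `μ`; it is empty if `μ` has at most `r` parts. -/
def block {n : ℕ} (μ : n.Partition) (r : ℕ) : Set (Fin n) :=
  {i | partialSum μ r ≤ (i : ℕ) ∧ (i : ℕ) < partialSum μ (r + 1)}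

open scoped Pointwise in
/-- The Young subgroup `Sym(μ) = Sym(X₁) × Sym(X₂) × ⋯`: the permutations that map every block
of `μ` onto itself. -/
def youngSubgroup {n : ℕ} (μ : n.Partition) : Subgroup (Equiv.Perm (Fin n)) :=
  ⨅ r, MulAction.stabilizer (Equiv.Perm (Fin n)) (block μ r)

open Classical in
/-- The element `[H] = ∑_{h ∈ H} h` of the group algebra. -/
noncomputable def setSum (R : Type*) [CommRing R] {G : Type*} [Group G] [Fintype G]
    (H : Set G) : MonoidAlgebra R G :=
  ∑ h : G with h ∈ H, MonoidAlgebra.of R G h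

/-- The two-sided ideal `I_R(Δ)` generated by the elements `[Sym(μ)]`, `μ ∈ Δ`. -/
noncomputable def youngIdeal (R : Type*) [CommRing R] {n : ℕ} (Δ : Set n.Partition) :
    TwoSidedIdeal (MonoidAlgebra R (Equiv.Perm (Fin n))) :=
  TwoSidedIdeal.span
    ((fun μ : n.Partition => setSum R (youngSubgroup μ : Set (Equiv.Perm (Fin n)))) '' Δ)

/-- The `R`-span `R H` in the group algebra of a set `H` of group elements. -/
noncomputable def setSpan (R : Type*) [CommRing R] {G : Type*} [Group G] (H : Set G) :
    Submodule R (MonoidAlgebra R G) :=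
  Submodule.span R (MonoidAlgebra.of R G '' H)

end SymGroupAlg

/-!
Let `σ` be a permutation with `sh(σ) ∈ Δ`, and choose `k` such that the `k`-th partial sum of
`sh(σ)` exceeds those of all partitions outside `Δ`. By the easy half of Greene's theorem, the word
of `σ` has `k` disjoint increasing subwords of total length `sh(σ)₁ + ⋯ + sh(σ)ₖ`: the rows of the
insertion tableau are such subwords of its reading word, and Knuth moves carry them to the word of
`σ` without changing their number or total length.

Cut `{1, …, n}` into the position sets of these subwords and singletons. The sizes form a partition
`μ` whose `k`-th partial sum is at least that of `sh(σ)`, so `μ ∈ Δ`. The stabilizer `H` of this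
decomposition is conjugate to `Sym(μ)`, so `σ [H] ∈ I_R(Δ)`; since `σ` increases on each class, it
is the lexicographically least element of `σ H`. Hence `σ` is congruent modulo `I_R(Δ)` to a
combination of lexicographically larger permutations, and descending induction concludes.
-/

open Relation

namespace SymGroupAlg

section KnuthStep

variable {α : Type*} [Preorder α]

/-- An elementary Knuth transformation of words, oriented so that undoing a row insertion is a
sequence of such steps. -/
inductive KnuthStep : List α → List α → Prop
  | swap_of_le_of_lt {x y z : α} (u v : List α) (hxy : x ≤ y) (hyz : y < z) :
      KnuthStep (u ++ z :: x :: y :: v) (u ++ x :: z :: y :: v)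
  | swap_of_lt_of_le {x y z : α} (u v : List α) (hxy : x < y) (hyz : y ≤ z) :
      KnuthStep (u ++ y :: x :: z :: v) (u ++ y :: z :: x :: v)

theorem KnuthStep.append_append {w w' : List α} (h : KnuthStep w w') (p q : List α) :
    KnuthStep (p ++ w ++ q) (p ++ w' ++ q) := by
  cases h with
  | swap_of_le_of_lt u v hxy hyz => simpa using swap_of_le_of_lt (p ++ u) (v ++ q) hxy hyz
  | swap_of_lt_of_le u v hxy hyz => simpa using swap_of_lt_of_le (p ++ u) (v ++ q) hxy hyz

theorem reflTransGen_knuthStep_append_append {w w' : List α} (h : ReflTransGen KnuthStep w w')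
    (p q : List α) : ReflTransGen KnuthStep (p ++ w ++ q) (p ++ w' ++ q) :=
  h.lift (p ++ · ++ q) fun _ _ h => h.append_append p q

theorem reflTransGen_knuthStep_cons_append {u : List α} {x y : α} (hxy : x < y)
    (hu : (u ++ [x]).Pairwise (· ≤ ·)) (v : List α) :
    ReflTransGen KnuthStep (y :: (u ++ x :: v)) (u ++ y :: x :: v) := by
  induction u with
  | nil => exact .refl
  | cons a u ih =>
    obtain ⟨ha, hu⟩ := List.pairwise_cons.1 hu
    have hstep : KnuthStep (y :: a :: (u ++ x :: v)) (a :: y :: (u ++ x :: v)) := by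
      cases u with
      | nil => exact .swap_of_le_of_lt [] v (ha x (by simp)) hxy
      | cons b u =>
        have hbx : b ≤ x := (List.pairwise_cons.1 hu).1 x (by simp)
        exact .swap_of_le_of_lt [] (u ++ x :: v) (ha b (by simp)) (hbx.trans_lt hxy)
    exact .head hstep (by simpa using reflTransGen_knuthStep_append_append (ih hu) [a] [])

theorem reflTransGen_knuthStep_cons_cons {v : List α} {x y : α} (hxy : x < y)
    (hv : (y :: v).Pairwise (· ≤ ·)) :
    ReflTransGen KnuthStep (y :: x :: v) (y :: v ++ [x]) := by
  induction v generalizing y with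
  | nil => exact .refl
  | cons a v ih =>
    obtain ⟨hy, hv⟩ := List.pairwise_cons.1 hv
    have hya : y ≤ a := hy a (by simp)
    exact .head (.swap_of_lt_of_le [] v hxy hya)
      (by simpa using reflTransGen_knuthStep_append_append (ih (hxy.trans_le hya) hv) [y] [])

theorem reflTransGen_knuthStep_bump {u v : List α} {x y : α} (hr : (u ++ y :: v).Pairwise (· ≤ ·))
    (hu : ∀ a ∈ u, a ≤ x) (hxy : x < y) :
    ReflTransGen KnuthStep (y :: (u ++ x :: v)) (u ++ y :: v ++ [x]) := by
  obtain ⟨hu', hyv, -⟩ := List.pairwise_append.1 hr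
  have hux : (u ++ [x]).Pairwise (· ≤ ·) := by simpa [List.pairwise_append, hu'] using hu
  exact (reflTransGen_knuthStep_cons_append hxy hux v).trans
    (by simpa using
      reflTransGen_knuthStep_append_append (reflTransGen_knuthStep_cons_cons hxy hyv) u [])

end KnuthStep

section RobinsonSchensted

variable {α : Type*}

/-- The row reading word of a tableau: its rows concatenated from the last to the first. -/
def readingWord (T : List (List α)) : List α := T.reverse.flatten

theorem readingWord_cons (r : List α) (T : List (List α)) :
    readingWord (r :: T) = readingWord T ++ r := by
  simp [readingWord]

variable [LinearOrder α]

theorem rowInsert_eq_append_or_bump (x : α) (r : List α) :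
    (rowInsert x r = (r ++ [x], none) ∧ ∀ a ∈ r, a ≤ x) ∨
      ∃ u y v, r = u ++ y :: v ∧ (∀ a ∈ u, a ≤ x) ∧ x < y ∧
        rowInsert x r = (u ++ x :: v, some y) := by
  induction r with
  | nil => simp [rowInsert]
  | cons z r ih =>
    by_cases hxz : x < z
    · exact Or.inr ⟨[], z, r, by simp [rowInsert, hxz]⟩
    · rcases ih with ⟨hr, hle⟩ | ⟨u, y, v, rfl, hle, hxy, hr⟩
      · exact Or.inl ⟨by simp [rowInsert, hxz, hr], by simpa [not_lt.1 hxz] using hle⟩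
      · exact Or.inr ⟨z :: u, y, v, rfl, by simpa [not_lt.1 hxz] using hle, hxy,
          by simp [rowInsert, hxz, hr]⟩

theorem pairwise_le_rowInsert {x : α} {r : List α} (hr : r.Pairwise (· ≤ ·)) :
    (rowInsert x r).1.Pairwise (· ≤ ·) := by
  rcases rowInsert_eq_append_or_bump x r with ⟨hins, hle⟩ | ⟨u, y, v, rfl, hle, hxy, hins⟩
  · rw [hins]
    simpa [List.pairwise_append, hr] using hle
  · rw [hins]
    simp only [List.pairwise_append, List.pairwise_cons, List.mem_cons, forall_eq_or_imp] at hr ⊢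
    obtain ⟨hu, ⟨hyv, hv⟩, huv⟩ := hr
    exact ⟨hu, ⟨fun b hb => hxy.le.trans (hyv b hb), hv⟩, fun a ha => ⟨hle a ha, (huv a ha).2⟩⟩

theorem pairwise_le_tableauInsert {T : List (List α)} {x : α}
    (hT : ∀ r ∈ T, r.Pairwise (· ≤ ·)) : ∀ r ∈ tableauInsert x T, r.Pairwise (· ≤ ·) := by
  induction T generalizing x with
  | nil => simp [tableauInsert]
  | cons r T ih =>
    obtain ⟨hr, hrows⟩ := List.forall_mem_cons.1 hT
    rw [tableauInsert]
    cases (rowInsert x r).2 with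
    | none => exact List.forall_mem_cons.2 ⟨pairwise_le_rowInsert hr, hrows⟩
    | some y => exact List.forall_mem_cons.2 ⟨pairwise_le_rowInsert hr, ih hrows⟩

theorem insertionTableau_append_singleton (w : List α) (x : α) :
    insertionTableau (w ++ [x]) = tableauInsert x (insertionTableau w) := by
  simp [insertionTableau]

theorem pairwise_le_insertionTableau (w : List α) :
    ∀ r ∈ insertionTableau w, r.Pairwise (· ≤ ·) := by
  induction w using List.reverseRecOn with
  | nil => simp [insertionTableau]
  | append_singleton w x ih =>
    rw [insertionTableau_append_singleton]
    exact pairwise_le_tableauInsert ih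

theorem reflTransGen_knuthStep_tableauInsert {T : List (List α)} {x : α}
    (hT : ∀ r ∈ T, r.Pairwise (· ≤ ·)) :
    ReflTransGen KnuthStep (readingWord (tableauInsert x T)) (readingWord T ++ [x]) := by
  induction T generalizing x with
  | nil => exact .refl
  | cons r T ih =>
    obtain ⟨hr, hrows⟩ := List.forall_mem_cons.1 hT
    rw [tableauInsert]
    rcases rowInsert_eq_append_or_bump x r with ⟨hins, -⟩ | ⟨u, y, v, rfl, hu, hxy, hins⟩
    · simp only [hins, readingWord_cons, List.append_assoc]
      exact .refl
    · simp only [hins, readingWord_cons]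
      have htail := reflTransGen_knuthStep_append_append (ih hrows (x := y)) [] (u ++ x :: v)
      have hrow := reflTransGen_knuthStep_append_append (reflTransGen_knuthStep_bump hr hu hxy)
        (readingWord T) []
      simpa using htail.trans (by simpa using hrow)

theorem reflTransGen_knuthStep_insertionTableau (w : List α) :
    ReflTransGen KnuthStep (readingWord (insertionTableau w)) w := by
  induction w using List.reverseRecOn with
  | nil => exact .refl
  | append_singleton w x ih =>
    rw [insertionTableau_append_singleton]
    exact (reflTransGen_knuthStep_tableauInsert (pairwise_le_insertionTableau w)).trans
      (by simpa using reflTransGen_knuthStep_append_append ih [] [x])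

end RobinsonSchensted

section Coloring

theorem exists_eq_append_cons₃_of_map_eq {α β : Type*} {f : β → α} {L : List β} {A B : List α}
    {a b c : α} (h : L.map f = A ++ a :: b :: c :: B) :
    ∃ A' a' b' c' B', L = A' ++ a' :: b' :: c' :: B' ∧ A'.map f = A ∧ f a' = a ∧ f b' = b ∧
      f c' = c ∧ B'.map f = B := by
  obtain ⟨A', L₁, rfl, hA, h₁⟩ := List.map_eq_append_iff.1 h
  obtain ⟨a', L₂, rfl, ha, h₂⟩ := List.map_eq_cons_iff.1 h₁
  obtain ⟨b', L₃, rfl, hb, h₃⟩ := List.map_eq_cons_iff.1 h₂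
  obtain ⟨c', B', rfl, hc, hB⟩ := List.map_eq_cons_iff.1 h₃
  exact ⟨A', a', b', c', B', rfl, hA, ha, hb, hc, hB⟩

theorem card_filter_get {β : Type*} (L : List β) (p : β → Bool) :
    (Finset.univ.filter fun i => p (L.get i)).card = L.countP p := by
  have hL : (L : Multiset β) = Finset.univ.val.map L.get := by rw [Fin.univ_val_map, List.ofFn_get]
  calc (Finset.univ.filter fun i => p (L.get i)).card
      = (Finset.univ.val.map L.get).countP (p ·) := by
        rw [Multiset.countP_map]; rfl
    _ = L.countP p := by rw [← hL, Multiset.coe_countP]; simp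

variable {α ι : Type*} [DecidableEq ι]

/-- The subword of letters of colour `c` in a word whose letters carry an optional colour. -/
def colorClass (c : ι) (L : List (α × Option ι)) : List α :=
  L.filterMap fun a => if a.2 = some c then some a.1 else none

theorem colorClass_append (c : ι) (L L' : List (α × Option ι)) :
    colorClass c (L ++ L') = colorClass c L ++ colorClass c L' :=
  List.filterMap_append

theorem colorClass_cons (c : ι) (a : α × Option ι) (L : List (α × Option ι)) :
    colorClass c (a :: L) = if a.2 = some c then a.1 :: colorClass c L else colorClass c L := by
  by_cases h : a.2 = some c <;> simp [colorClass, h]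

theorem colorClass_swap {a b : α × Option ι} (hab : ∀ c, a.2 = some c → b.2 ≠ some c) (c : ι)
    (A B : List (α × Option ι)) :
    colorClass c (A ++ a :: b :: B) = colorClass c (A ++ b :: a :: B) := by
  have := hab c
  simp only [colorClass_append, colorClass_cons]
  split_ifs <;> simp_all

theorem colorClass_map_of_injective {ι' : Type*} [DecidableEq ι'] {π : ι → ι'}
    (hπ : Function.Injective π) (c : ι) (L : List (α × Option ι)) :
    colorClass (π c) (L.map (Prod.map id (Option.map π))) = colorClass c L := by
  simp [colorClass, List.filterMap_map, hπ.eq_iff]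

theorem colorClass_map_perm (π : Equiv.Perm ι) (c : ι) (L : List (α × Option ι)) :
    colorClass c (L.map (Prod.map id (Option.map π))) = colorClass (π⁻¹ c) L := by
  simpa using colorClass_map_of_injective π.injective (π⁻¹ c) L

variable [Preorder α]

/-- A colouring is monotone if the letters of each colour form a weakly increasing subword;
letters without a colour are unrestricted. -/
def IsMonotoneColoring (L : List (α × Option ι)) : Prop :=
  ∀ c, (colorClass c L).Pairwise (· ≤ ·)

theorem IsMonotoneColoring.swap {a b : α × Option ι} {A B : List (α × Option ι)}
    (h : IsMonotoneColoring (A ++ a :: b :: B)) (hab : ∀ c, a.2 = some c → b.2 ≠ some c) :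
    IsMonotoneColoring (A ++ b :: a :: B) := fun c =>
  colorClass_swap hab c A B ▸ h c

theorem IsMonotoneColoring.ne_of_lt {a b : α × Option ι} {A B : List (α × Option ι)}
    (h : IsMonotoneColoring (A ++ a :: b :: B)) (hba : b.1 < a.1) (c : ι) (ha : a.2 = some c) :
    b.2 ≠ some c := by
  intro hb
  have hc := h c
  simp only [colorClass_append, colorClass_cons, ha, hb, if_true, List.pairwise_append,
    List.pairwise_cons, List.mem_cons, forall_eq_or_imp] at hc
  exact hba.not_ge hc.2.1.1.1

theorem pairwise_le_append_cons_cons_of_le {A B : List α} {x y z : α} (hxy : x ≤ y) (hyz : y ≤ z)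
    (h : (A ++ x :: z :: B).Pairwise (· ≤ ·)) : (A ++ y :: z :: B).Pairwise (· ≤ ·) := by
  simp only [List.pairwise_append, List.pairwise_cons, List.mem_cons, forall_eq_or_imp] at h ⊢
  grind

theorem pairwise_le_exchange_tails {A B A' B' : List α} {x y z : α} (hxy : x ≤ y) (hyz : y ≤ z)
    (h : (A ++ y :: B).Pairwise (· ≤ ·)) (h' : (A' ++ x :: z :: B').Pairwise (· ≤ ·)) :
    (A ++ y :: z :: B').Pairwise (· ≤ ·) ∧ (A' ++ x :: B).Pairwise (· ≤ ·) := by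
  simp only [List.pairwise_append, List.pairwise_cons, List.mem_cons, forall_eq_or_imp] at h h' ⊢
  grind

theorem IsMonotoneColoring.recolor_of_none {A B : List (α × Option ι)} {x y z : α} {c : ι}
    (h : IsMonotoneColoring (A ++ (y, none) :: (x, some c) :: (z, some c) :: B)) (hxy : x ≤ y)
    (hyz : y ≤ z) : IsMonotoneColoring (A ++ (y, some c) :: (z, some c) :: (x, none) :: B) := by
  intro d
  have hd := h d
  by_cases hdc : c = d
  · subst hdc
    simp only [colorClass_append, colorClass_cons, reduceCtorEq, if_true, if_false] at hd ⊢
    exact pairwise_le_append_cons_cons_of_le hxy hyz hd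
  · simpa [colorClass_append, colorClass_cons, hdc] using hd

-- The two subwords through `y` and through `x, z` exchange their tails at this point; recolouring
-- the prefix instead of the tail keeps `B` unchanged.
theorem IsMonotoneColoring.exchange_colors {A B : List (α × Option ι)} {x y z : α} {c e : ι}
    (h : IsMonotoneColoring (A ++ (y, some e) :: (x, some c) :: (z, some c) :: B)) (hce : c ≠ e)
    (hxy : x ≤ y) (hyz : y ≤ z) :
    IsMonotoneColoring (A.map (Prod.map id (Option.map (Equiv.swap c e))) ++
      (y, some c) :: (z, some c) :: (x, some e) :: B) := by
  have hc := h c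
  have he := h e
  simp only [colorClass_append, colorClass_cons, Option.some.injEq, hce, hce.symm, if_true,
    if_false] at hc he
  obtain ⟨hc', he'⟩ := pairwise_le_exchange_tails hxy hyz he hc
  intro d
  simp only [colorClass_append, colorClass_cons, colorClass_map_perm, Equiv.swap_inv,
    Option.some.injEq]
  by_cases hcd : c = d
  · subst hcd
    simpa [hce.symm] using hc'
  by_cases hed : e = d
  · subst hed
    simpa [hce] using he'
  · simpa [colorClass_append, colorClass_cons, hcd, hed,
      Equiv.swap_apply_of_ne_of_ne (Ne.symm hcd) (Ne.symm hed)] using h d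

/-- The word `w` contains disjoint weakly increasing subwords, indexed by `ι`, of total length
`s`. -/
def HasMonotoneSubwords (ι : Type*) [DecidableEq ι] (s : ℕ) (w : List α) : Prop :=
  ∃ L : List (α × Option ι), L.map Prod.fst = w ∧ IsMonotoneColoring L ∧
    L.countP (fun a => a.2.isSome) = s

theorem HasMonotoneSubwords.knuthStep {s : ℕ} {w w' : List α} (hstep : KnuthStep w w')
    (h : HasMonotoneSubwords ι s w) : HasMonotoneSubwords ι s w' := by
  obtain ⟨L, hw, hL, rfl⟩ := h
  cases hstep with
  | swap_of_le_of_lt _ _ hxy hyz =>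
    obtain ⟨A, ⟨z, oz⟩, ⟨x, ox⟩, ⟨y, oy⟩, B, rfl, rfl, rfl, rfl, rfl, rfl⟩ :=
      exists_eq_append_cons₃_of_map_eq hw
    exact ⟨_, by simp, hL.swap (hL.ne_of_lt (hxy.trans_lt hyz)),
      ((List.Perm.swap _ _ _).append_left A).countP_eq _⟩
  | swap_of_lt_of_le _ _ hxy hyz =>
    obtain ⟨A, ⟨y, oy⟩, ⟨x, ox⟩, ⟨z, oz⟩, B, rfl, rfl, rfl, rfl, rfl, rfl⟩ :=
      exists_eq_append_cons₃_of_map_eq hw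
    by_cases hxz : ∀ c, ox = some c → oz ≠ some c
    · rw [List.append_cons] at hL ⊢
      exact ⟨_, by simp, hL.swap hxz, ((List.Perm.swap _ _ _).append_left _).countP_eq _⟩
    · push Not at hxz
      obtain ⟨c, rfl, rfl⟩ := hxz
      cases oy with
      | none => exact ⟨_, by simp, hL.recolor_of_none hxy.le hyz, by simp⟩
      | some e =>
        have hce : c ≠ e := fun hce => hL.ne_of_lt hxy c (by simp [hce]) rfl
        exact ⟨_, by simp, hL.exchange_colors hce hxy.le hyz, by simp [Function.comp_def]⟩

theorem HasMonotoneSubwords.reflTransGen_knuthStep {s : ℕ} {w w' : List α}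
    (h : HasMonotoneSubwords ι s w) (hw : ReflTransGen KnuthStep w w') :
    HasMonotoneSubwords ι s w' := by
  induction hw with
  | refl => exact h
  | tail _ hstep ih => exact ih.knuthStep hstep

theorem HasMonotoneSubwords.append_right {s : ℕ} {w : List α} (h : HasMonotoneSubwords ι s w)
    (r : List α) : HasMonotoneSubwords ι s (w ++ r) := by
  obtain ⟨L, rfl, hL, rfl⟩ := h
  refine ⟨L ++ r.map fun a => (a, none), by simp [Function.comp_def], fun c => ?_,
    by simp [List.countP_map, Function.comp_def]⟩
  simpa [colorClass] using hL c

theorem HasMonotoneSubwords.append_row {k s : ℕ} {w r : List α}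
    (h : HasMonotoneSubwords (Fin k) s w) (hr : r.Pairwise (· ≤ ·)) :
    HasMonotoneSubwords (Fin (k + 1)) (s + r.length) (w ++ r) := by
  obtain ⟨L, rfl, hL, rfl⟩ := h
  refine ⟨L.map (Prod.map id (Option.map Fin.succ)) ++ r.map fun a => (a, some 0),
    by simp [Function.comp_def], fun c => ?_, by simp [List.countP_map, Function.comp_def]⟩
  rw [colorClass_append]
  cases c using Fin.cases with
  | zero => simpa [colorClass, List.filterMap_map, Function.comp_def] using hr
  | succ c =>
    rw [colorClass_map_of_injective (Fin.succ_injective k)]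
    simpa [colorClass, List.filterMap_map, Function.comp_def, (Fin.succ_ne_zero c).symm] using hL c

theorem hasMonotoneSubwords_readingWord {S T : List (List α)} {k : ℕ} (hST : S.Sublist T)
    (hk : S.length ≤ k) (hT : ∀ r ∈ T, r.Pairwise (· ≤ ·)) :
    HasMonotoneSubwords (Fin k) (S.map List.length).sum (readingWord T) := by
  induction hST generalizing k with
  | slnil => exact ⟨[], rfl, fun _ => List.Pairwise.nil, rfl⟩
  | cons r _ ih =>
    rw [readingWord_cons]
    exact (ih hk (List.forall_mem_cons.1 hT).2).append_right r
  | cons_cons r _ ih =>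
    obtain ⟨hr, hrows⟩ := List.forall_mem_cons.1 hT
    obtain ⟨k, rfl⟩ := Nat.exists_eq_add_one_of_ne_zero (Nat.ne_zero_of_lt hk)
    rw [readingWord_cons, List.map_cons, List.sum_cons, add_comm r.length]
    exact (ih (by simpa using hk) hrows).append_row hr

theorem hasMonotoneSubwords_of_sublist_insertionTableau {α : Type*} [LinearOrder α]
    {S : List (List α)} {w : List α} {k : ℕ} (hS : S.Sublist (insertionTableau w))
    (hk : S.length ≤ k) :
    HasMonotoneSubwords (Fin k) (S.map List.length).sum w :=
  (hasMonotoneSubwords_readingWord hS hk (pairwise_le_insertionTableau w)).reflTransGen_knuthStep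
    (reflTransGen_knuthStep_insertionTableau w)

theorem HasMonotoneSubwords.exists_strictMono_on_fibers {α : Type*} [PartialOrder α]
    {n s : ℕ} {σ : Fin n → α} (hσ : Function.Injective σ)
    (h : HasMonotoneSubwords ι s (List.ofFn σ)) :
    ∃ f : Fin n → ι ⊕ Fin n, (∀ i j, f i = f j → i < j → σ i < σ j) ∧
      (Finset.univ.filter fun i => (f i).isLeft).card = s := by
  obtain ⟨L, hL, hmono, rfl⟩ := h
  obtain rfl : L.length = n := by simpa using congrArg List.length hL
  have hget (i : Fin L.length) : (L.get i).1 = σ i := by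
    simpa using congrArg (fun l => l[(i : ℕ)]?) hL
  refine ⟨fun i => (L.get i).2.elim (Sum.inr i) Sum.inl, fun i j hf hij => ?_, ?_⟩
  · obtain ⟨c, hi, hj⟩ : ∃ c, (L.get i).2 = some c ∧ (L.get j).2 = some c := by
      cases hi : (L.get i).2 <;> cases hj : (L.get j).2 <;> simp_all
    have hle := List.pairwise_iff_get.1 (List.pairwise_filterMap.1 (hmono c)) i j hij
    simp only [hi, hj, hget, if_true, Option.some.injEq, forall_eq'] at hle
    exact hle.lt_of_ne (hσ.ne hij.ne)
  · rw [← card_filter_get]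
    congr with i
    change ((L.get i).2.elim (Sum.inr i) Sum.inl).isLeft = true ↔ (L.get i).2.isSome = true
    cases (L.get i).2 <;> simp

end Coloring

section Dominance

variable {n : ℕ}

theorem sum_le_sum_take_of_sublist {M : Type*} [AddCommMonoid M] [PartialOrder M]
    [IsOrderedAddMonoid M] [CanonicallyOrderedAdd M] {l l' : List M} {k : ℕ}
    (hl : l.Pairwise (· ≥ ·)) (hl' : l'.Sublist l) (hk : l'.length ≤ k) :
    l'.sum ≤ (l.take k).sum := by
  induction l generalizing l' k with
  | nil => simp [List.sublist_nil.1 hl']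
  | cons a l ih =>
    obtain ⟨ha, hl⟩ := List.pairwise_cons.1 hl
    cases l' with
    | nil => simp
    | cons b l' =>
      obtain ⟨k, rfl⟩ := Nat.exists_eq_add_one_of_ne_zero (Nat.ne_zero_of_lt hk)
      have hba : b ≤ a := by
        rcases List.mem_cons.1 (hl'.subset List.mem_cons_self) with rfl | hb
        exacts [le_rfl, ha b hb]
      simpa using add_le_add hba (ih hl hl'.tail (by simpa using hk))

theorem isGreatest_partialSum (μ : n.Partition) (k : ℕ) :
    IsGreatest {s | ∃ M ≤ μ.parts, M.card ≤ k ∧ M.sum = s} (partialSum μ k) := by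
  have hparts : (sortedParts μ : Multiset ℕ) = μ.parts := Multiset.sort_eq _ _
  refine ⟨⟨(sortedParts μ).take k, ?_, by simp, by simp [partialSum]⟩, ?_⟩
  · exact hparts ▸ Multiset.coe_le.2 (List.take_sublist _ _).subperm
  · rintro _ ⟨M, hM, hk, rfl⟩
    induction M using Quotient.inductionOn with | h l =>
    obtain ⟨l', hperm, hsub⟩ : l.Subperm (sortedParts μ) := Multiset.coe_le.1 (hparts ▸ hM)
    calc l.sum = l'.sum := hperm.sum_eq.symm
      _ ≤ partialSum μ k := sum_le_sum_take_of_sublist (Multiset.pairwise_sort _ _) hsub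
          (hperm.length_eq.trans_le hk)

-- Taking `k` longest rows, rather than the first `k`, avoids proving that row lengths decrease.
theorem hasMonotoneSubwords_partialSum_shape (σ : Equiv.Perm (Fin n)) (k : ℕ) :
    HasMonotoneSubwords (Fin k) (partialSum (shape σ) k) (List.ofFn σ) := by
  obtain ⟨M, hM, hcard, hsum⟩ := (isGreatest_partialSum (shape σ) k).1
  induction M using Quotient.inductionOn with | h l =>
  obtain ⟨l', hperm, hsub⟩ : l.Subperm ((insertionTableau (List.ofFn σ)).map List.length) :=
    Multiset.coe_le.1 hM
  obtain ⟨S, hS, rfl⟩ := List.sublist_map_iff.1 hsub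
  have hlen : S.length ≤ k := by simpa using hperm.length_eq.trans_le hcard
  have hS' : (S.map List.length).sum = partialSum (shape σ) k := hperm.sum_eq.trans hsum
  exact hS' ▸ hasMonotoneSubwords_of_sublist_insertionTableau hS hlen

/-- The partition of `n` given by the sizes of the nonempty fibres of a function on `Fin n`;
the set partition itself is encoded by the function, whose codomain is irrelevant. -/
def fiberPartition {κ : Type*} [DecidableEq κ] (f : Fin n → κ) : n.Partition where
  parts := (Finset.univ.image f).val.map fun c => (Finset.univ.filter fun i => f i = c).card
  parts_pos := by
    intro s hs
    obtain ⟨c, hc, rfl⟩ := Multiset.mem_map.1 hs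
    obtain ⟨i, -, rfl⟩ := Finset.mem_image.1 (show c ∈ Finset.univ.image f from hc)
    exact Finset.card_pos.2 ⟨i, by simp⟩
  parts_sum := by
    change ∑ c ∈ Finset.univ.image f, (Finset.univ.filter fun i => f i = c).card = n
    rw [← Finset.card_eq_sum_card_image, Finset.card_univ, Fintype.card_fin]

theorem card_filter_mem_le_partialSum_fiberPartition {κ : Type*} [DecidableEq κ] (f : Fin n → κ)
    {K : Finset κ} {k : ℕ} (hK : K.card ≤ k) :
    (Finset.univ.filter fun i => f i ∈ K).card ≤ partialSum (fiberPartition f) k := by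
  refine (isGreatest_partialSum (fiberPartition f) k).2 ⟨(K ∩ Finset.univ.image f).val.map _,
    Multiset.map_le_map (Finset.val_le_iff.2 Finset.inter_subset_right), ?_, ?_⟩
  · exact (Multiset.card_map _ _).trans_le ((Finset.card_le_card Finset.inter_subset_left).trans hK)
  · change ∑ c ∈ K ∩ Finset.univ.image f, (Finset.univ.filter fun i => f i = c).card = _
    simp [Finset.sum_card_fiberwise_eq_card_filter]

theorem exists_strictMono_on_fibers_partialSum_shape_le (σ : Equiv.Perm (Fin n)) (k : ℕ) :
    ∃ f : Fin n → Fin k ⊕ Fin n, (∀ i j, f i = f j → i < j → σ i < σ j) ∧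
      partialSum (shape σ) k ≤ partialSum (fiberPartition f) k := by
  obtain ⟨f, hf, hcard⟩ :=
    (hasMonotoneSubwords_partialSum_shape σ k).exists_strictMono_on_fibers σ.injective
  refine ⟨f, hf, ?_⟩
  rw [← hcard]
  convert card_filter_mem_le_partialSum_fiberPartition f
    (k := k) (K := (Finset.univ : Finset (Fin k)).disjSum ∅) (by simp) using 3 with i
  cases f i <;> simp

end Dominance

section YoungSubgroup

variable {n : ℕ} {κ κ' : Type*}

theorem exists_equiv_comp_eq_of_map_univ_eq {β γ : Type*} [Fintype β] [Fintype γ] {p : β → κ}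
    {q : γ → κ} (h : Finset.univ.val.map p = Finset.univ.val.map q) :
    ∃ e : β ≃ γ, ∀ b, q (e b) = p b := by
  classical
  have hcard (r : κ) : Fintype.card {b // p b = r} = Fintype.card {c // q c = r} := by
    have hcount := congrArg (Multiset.count r) h
    simp only [Multiset.count_map, eq_comm (a := r)] at hcount
    rw [Fintype.card_subtype, Fintype.card_subtype]
    exact hcount
  exact ⟨Equiv.ofFiberEquiv fun r => Fintype.equivOfCardEq (hcard r), Equiv.ofFiberEquiv_map _⟩

theorem exists_perm_of_fiberPartition_eq [DecidableEq κ] [DecidableEq κ'] {f : Fin n → κ}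
    {g : Fin n → κ'} (h : fiberPartition f = fiberPartition g) :
    ∃ π : Equiv.Perm (Fin n), ∀ i j, f (π i) = f (π j) ↔ g i = g j := by
  let sizeF (c : κ) : ℕ := (Finset.univ.filter fun i => f i = c).card
  let sizeG (c : κ') : ℕ := (Finset.univ.filter fun i => g i = c).card
  obtain ⟨e, he⟩ : ∃ e : Finset.univ.image g ≃ Finset.univ.image f,
      ∀ c, sizeF (e c) = sizeG c := by
    refine exists_equiv_comp_eq_of_map_univ_eq (q := fun c : Finset.univ.image f => sizeF c) ?_
    calc Finset.univ.val.map (fun c : Finset.univ.image g => sizeG c)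
        = (fiberPartition g).parts := Multiset.attach_map_val' (Finset.univ.image g).val sizeG
      _ = (fiberPartition f).parts := by rw [h]
      _ = Finset.univ.val.map (fun c : Finset.univ.image f => sizeF c) :=
          (Multiset.attach_map_val' (Finset.univ.image f).val sizeF).symm
  let f' (i : Fin n) : Finset.univ.image f := ⟨f i, by simp⟩
  let g' (i : Fin n) : Finset.univ.image f := e ⟨g i, by simp⟩
  have hcard (c) : Fintype.card {i // g' i = c} = Fintype.card {i // f' i = c} := by
    have hf : Fintype.card {i // f' i = c} = sizeF c := by
      simp [Fintype.card_subtype, sizeF, f', Subtype.ext_iff]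
    have hg : Fintype.card {i // g' i = c} = sizeG (e.symm c) := by
      simp [Fintype.card_subtype, sizeG, g', Subtype.ext_iff, ← Equiv.eq_symm_apply]
    rw [hf, hg, ← he, e.apply_symm_apply]
  let π : Equiv.Perm (Fin n) := .ofFiberEquiv fun c => Fintype.equivOfCardEq (hcard c)
  have hπ (i : Fin n) : f' (π i) = g' i := Equiv.ofFiberEquiv_map _ i
  refine ⟨π, fun i j => ?_⟩
  calc f (π i) = f (π j) ↔ f' (π i) = f' (π j) := Subtype.mk_eq_mk.symm
    _ ↔ g' i = g' j := by rw [hπ, hπ]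
    _ ↔ g i = g j := e.apply_eq_iff_eq.trans Subtype.mk_eq_mk

/-- The composition of `n` whose blocks are the parts of `μ` in weakly decreasing order; its
`index` function has the sets `block μ r` as fibres. -/
def sortedComposition (μ : n.Partition) : Composition n where
  blocks := sortedParts μ
  blocks_pos hi := μ.parts_pos (by simpa [sortedParts] using hi)
  blocks_sum := by
    rw [← Multiset.sum_coe, sortedParts, Multiset.sort_eq, μ.parts_sum]

theorem fiberPartition_index (c : Composition n) :
    fiberPartition c.index = Nat.Partition.ofComposition n c := by
  have hcard (i : Fin c.length) :
      (Finset.univ.filter fun j => c.index j = i).card = c.blocksFun i := by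
    have : (Finset.univ.filter fun j => c.index j = i) =
        Finset.univ.map (c.embedding i).toEmbedding := by
      ext j
      simpa [eq_comm] using (c.mem_range_embedding_iff' (j := j) (i := i)).symm
    rw [this, Finset.card_map, Finset.card_univ, Fintype.card_fin]
  have hsurj : Finset.univ.image c.index = Finset.univ :=
    Finset.image_univ_of_surjective fun i => ⟨_, c.index_embedding i ⟨0, c.one_le_blocksFun i⟩⟩
  ext1
  simp only [fiberPartition, hsurj, hcard, Fin.univ_val_map, c.ofFn_blocksFun]
  rfl

theorem fiberPartition_index_sortedComposition (μ : n.Partition) :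
    fiberPartition (sortedComposition μ).index = μ := by
  rw [fiberPartition_index]
  exact Nat.Partition.ext (Multiset.sort_eq _ _)

theorem mem_block_iff {μ : n.Partition} {r : ℕ} {i : Fin n} :
    i ∈ block μ r ↔ ((sortedComposition μ).index i : ℕ) = r := by
  have hle := (sortedComposition μ).sizeUpTo_index_le i
  have hlt := (sortedComposition μ).lt_sizeUpTo_index_succ i
  have hmono := (sortedComposition μ).monotone_sizeUpTo
  constructor
  · rintro ⟨hr, hr'⟩
    exact le_antisymm (Nat.lt_succ_iff.1 (hmono.reflect_lt (hle.trans_lt hr')))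
      (Nat.lt_succ_iff.1 (hmono.reflect_lt (hr.trans_lt hlt)))
  · rintro rfl
    exact ⟨hle, hlt⟩

/-- The permutations that map every fibre of `f` to itself: a Young subgroup, up to
conjugation. -/
def fiberSubgroup {β : Type*} (f : β → κ) : Subgroup (Equiv.Perm β) where
  carrier := {τ | ∀ i, f (τ i) = f i}
  one_mem' _ := rfl
  mul_mem' hσ hτ i := (hσ _).trans (hτ i)
  inv_mem' {τ} hτ i := by simpa using (hτ (τ⁻¹ i)).symm

theorem youngSubgroup_eq_fiberSubgroup (μ : n.Partition) :
    youngSubgroup μ = fiberSubgroup (sortedComposition μ).index := by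
  ext τ
  simp only [youngSubgroup, Subgroup.mem_iInf, MulAction.mem_stabilizer_set, mem_block_iff]
  exact ⟨fun h i => Fin.ext ((h _ i).2 rfl), fun h r i => by rw [Equiv.Perm.smul_def, h i]⟩

theorem coe_fiberSubgroup_eq_conj_image {β : Type*} {f : β → κ} {g : β → κ'} {π : Equiv.Perm β}
    (h : ∀ i j, f (π i) = f (π j) ↔ g i = g j) :
    (fiberSubgroup f : Set (Equiv.Perm β)) = MulAut.conj π '' fiberSubgroup g := by
  ext τ
  simp only [MulAut.conj_apply, Set.mem_image, SetLike.mem_coe]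
  constructor
  · refine fun hτ => ⟨π⁻¹ * τ * π, fun i => (h _ i).1 ?_, by group⟩
    simpa using hτ (π i)
  · rintro ⟨ρ, hρ, rfl⟩ i
    simpa using (h (ρ (π⁻¹ i)) (π⁻¹ i)).2 (hρ _)

variable (R : Type*) [CommRing R]

theorem of_mul_setSum_mul_of_inv {G : Type*} [Group G] [Fintype G] (g : G) (H : Set G) :
    MonoidAlgebra.of R G g * setSum R H * MonoidAlgebra.of R G g⁻¹ =
      setSum R (MulAut.conj g '' H) := by
  simp only [setSum, Finset.mul_sum, Finset.sum_mul, ← map_mul]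
  exact Finset.sum_equiv (MulAut.conj g).toEquiv (by simp) (by simp)

theorem setSum_fiberSubgroup_mem_youngIdeal [DecidableEq κ] {Δ : Set n.Partition} {f : Fin n → κ}
    (h : fiberPartition f ∈ Δ) : setSum R (fiberSubgroup f : Set _) ∈ youngIdeal R Δ := by
  obtain ⟨π, hπ⟩ := exists_perm_of_fiberPartition_eq
    (fiberPartition_index_sortedComposition (fiberPartition f)).symm
  rw [coe_fiberSubgroup_eq_conj_image hπ, ← youngSubgroup_eq_fiberSubgroup,
    ← of_mul_setSum_mul_of_inv]
  exact TwoSidedIdeal.mul_mem_right _ _ _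
    (TwoSidedIdeal.mul_mem_left _ _ _ (TwoSidedIdeal.subset_span ⟨_, h, rfl⟩))

end YoungSubgroup

section Triangularity

theorem toLex_lt_toLex_comp {α β κ : Type*} [LinearOrder α] [WellFoundedLT α] [Preorder β]
    {f : α → κ} {σ : α → β} (hσ : ∀ i j, f i = f j → i < j → σ i < σ j) {τ : Equiv.Perm α}
    (hτ : τ ∈ fiberSubgroup f) (hne : τ ≠ 1) : toLex σ < toLex (σ ∘ τ) := by
  obtain ⟨i, hi, hmin⟩ := exists_minimal_of_wellFoundedLT (fun i => τ i ≠ i) (by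
    simpa [Equiv.ext_iff] using hne)
  have hfix (j : α) (hj : j < i) : τ j = j := by
    by_contra h
    exact (hmin h hj.le).not_gt hj
  have hlt : i < τ i :=
    (lt_or_gt_of_ne hi).resolve_left fun hlt => hi (τ.injective (hfix _ hlt))
  exact ⟨i, fun j hj => congrArg σ (hfix j hj).symm, hσ i (τ i) (hτ i).symm hlt⟩

theorem eq_top_of_forall_of_mem_or_of_mul_setSum_mem {R G β : Type*} [CommRing R] [Group G]
    [Fintype G] [Preorder β] [WellFoundedGT β] {M : Submodule R (MonoidAlgebra R G)} (φ : G → β)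
    (h : ∀ g, MonoidAlgebra.of R G g ∈ M ∨ ∃ H : Set G, 1 ∈ H ∧
      MonoidAlgebra.of R G g * setSum R H ∈ M ∧ ∀ τ ∈ H, τ ≠ 1 → φ g < φ (g * τ)) :
    M = ⊤ := by
  classical
  have hof (g : G) : MonoidAlgebra.of R G g ∈ M := by
    induction g using (InvImage.wf φ (wellFounded_gt (α := β))).induction with | h g ih =>
    obtain hg | ⟨H, hone, hmem, hlt⟩ := h g
    · exact hg
    · rw [setSum, Finset.mul_sum, ← Finset.add_sum_erase _ _
        (Finset.mem_filter.2 ⟨Finset.mem_univ 1, hone⟩), map_one, mul_one] at hmem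
      refine (M.add_mem_iff_left (M.sum_mem fun τ hτ => ?_)).1 hmem
      simp only [Finset.mem_erase, Finset.mem_filter] at hτ
      rw [← map_mul]
      exact ih _ (hlt τ hτ.2.2 hτ.1)
  refine eq_top_iff.2 fun x _ => ?_
  induction x using MonoidAlgebra.induction_on with
  | of g => exact hof g
  | add x y hx hy => exact M.add_mem (hx trivial) (hy trivial)
  | smul r x hx => exact M.smul_mem r (hx trivial)

end Triangularity

theorem exists_compl_eq_Iic_of_existsUnique_maximal {α : Type*} [Preorder α] [Finite α]
    {s : Set α} (hs : IsUpperSet s) (hmax : ∃! a, Maximal (· ∈ sᶜ) a) : ∃ a, sᶜ = Set.Iic a := by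
  obtain ⟨a, ha, huniq⟩ := hmax
  refine ⟨a, Set.Subset.antisymm (fun b hb => ?_) fun b hb => hs.compl hb ha.1⟩
  obtain ⟨m, hbm, hm⟩ := Finite.exists_le_maximal hb
  exact huniq m hm ▸ hbm

theorem exists_setSum_mem_youngIdeal_and_toLex_lt (R : Type*) [CommRing R] {n : ℕ}
    {Δ : Set n.Partition} {σ : Equiv.Perm (Fin n)} {k : ℕ}
    (hk : ∀ ν ∉ Δ, partialSum ν k < partialSum (shape σ) k) :
    ∃ H : Subgroup (Equiv.Perm (Fin n)), setSum R (H : Set _) ∈ youngIdeal R Δ ∧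
      ∀ τ ∈ H, τ ≠ 1 → toLex (σ : Fin n → Fin n) < toLex ⇑(σ * τ) := by
  obtain ⟨f, hf, hle⟩ := exists_strictMono_on_fibers_partialSum_shape_le σ k
  have hfΔ : fiberPartition f ∈ Δ := by
    by_contra h
    exact (hk _ h).not_ge hle
  exact ⟨fiberSubgroup f, setSum_fiberSubgroup_mem_youngIdeal R hfΔ,
    fun τ hτ hne => toLex_lt_toLex_comp hf hτ hne⟩

end SymGroupAlg

theorem lemma2p5_general (R : Type*) [CommRing R] (n : ℕ) (Δ : Set n.Partition)
    (hΔ : ∀ μ ∈ Δ, ∃ k, ∀ ν ∉ Δ, SymGroupAlg.partialSum ν k < SymGroupAlg.partialSum μ k) :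
    (⊤ : Submodule R (MonoidAlgebra R (Equiv.Perm (Fin n)))) =
      SymGroupAlg.setSpan R (SymGroupAlg.permsOfShape Δᶜ) ⊔
        (SymGroupAlg.youngIdeal R Δ).asIdeal.restrictScalars R := by
  symm
  refine SymGroupAlg.eq_top_of_forall_of_mem_or_of_mul_setSum_mem (fun σ => toLex ⇑σ) fun σ => ?_
  by_cases hσ : SymGroupAlg.shape σ ∈ Δ
  · right
    obtain ⟨k, hk⟩ := hΔ _ hσ
    obtain ⟨H, hH, hlt⟩ := SymGroupAlg.exists_setSum_mem_youngIdeal_and_toLex_lt R hk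
    exact ⟨H, H.one_mem, Submodule.mem_sup_right (TwoSidedIdeal.mul_mem_left _ _ _ hH), hlt⟩
  · exact .inl (Submodule.mem_sup_left (Submodule.subset_span ⟨σ, hσ, rfl⟩))

/-- "Co-saturated" is `IsUpperSet` for the dominance order. -/
theorem lemma2p5 (R : Type*) [CommRing R] (n : ℕ) (Δ : Set n.Partition)
    (hΔ : IsUpperSet Δ) (hmax : ∃! μ : n.Partition, Maximal (fun ν => ν ∈ Δᶜ) μ) :
    (⊤ : Submodule R (MonoidAlgebra R (Equiv.Perm (Fin n)))) =
      SymGroupAlg.setSpan R (SymGroupAlg.permsOfShape Δᶜ) ⊔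
        (SymGroupAlg.youngIdeal R Δ).asIdeal.restrictScalars R := by
  obtain ⟨lam, hlam⟩ := SymGroupAlg.exists_compl_eq_Iic_of_existsUnique_maximal hΔ hmax
  refine lemma2p5_general R n Δ fun μ hμ => ?_
  obtain ⟨k, hk⟩ : ∃ k, SymGroupAlg.partialSum lam k < SymGroupAlg.partialSum μ k := by
    by_contra! hle
    exact hlam.ge hle hμ
  exact ⟨k, fun ν hν => (hlam.le hν k).trans_lt hk⟩
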